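/- Let $G$ be a finite simple graph that is connected, cubic (every vertex has degree $3$) and claw-free (no induced subgraph is isomorphic to $K_{1,3}$), and suppose that $G$ is not isomorphic to $K_4$. Then (a) $Z(G) \le \alpha(G) + 1$, and (b) $Z(G) \le \alpha'(G)$. Here $\alpha(G)$ is the independence number (the maximum number of pairwise non-adjacent vertices) and $\alpha'(G)$ is the matching number (the maximum number of edges in a matching). The zero forcing number $Z(G)$ is the minimum cardinality of a zero forcing set, that is, of a set $S \subseteq V(G)$ of initially colored vertices such that every vertex of $G$ eventually becomes colored when the following rule is applied repeatedly: whenever a colored vertex has exactly one uncolored neighbor, that neighbor becomes colored. -/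

import Mathlib

namespace SimpleGraph

/-- A graph is claw-free if it has no induced subgraph isomorphic to `K_{1,3}`. -/
def ClawFree {V : Type*} (G : SimpleGraph V) : Prop :=
  ¬ (completeBipartiteGraph (Fin 1) (Fin 3)).IsIndContained G

/-- One time step of the zero forcing process: starting from the set `C` of colored vertices,
every colored vertex with exactly one uncolored neighbor forces that neighbor to become colored. -/
def forcingStep {V : Type*} (G : SimpleGraph V) (C : Set V) : Set V :=
  C ∪ {w | ∃ v ∈ C, G.neighborSet v \ C = {w}}

/-- `S` is a zero forcing set if iterating the color change rule, starting from `S`, eventually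
colors all vertices. -/
def IsZeroForcingSet {V : Type*} (G : SimpleGraph V) (S : Set V) : Prop :=
  ∃ t : ℕ, G.forcingStep^[t] S = Set.univ

/-- The zero forcing number of a finite graph: the minimum cardinality of a zero forcing set. -/
noncomputable def zeroForcingNumber {V : Type*} (G : SimpleGraph V) : ℕ :=
  sInf {k | ∃ S : Finset V, G.IsZeroForcingSet (S : Set V) ∧ S.card = k}

/-- The matching number of a finite graph: the maximum number of edges of a matching. -/
noncomputable def matchingNumber {V : Type*} (G : SimpleGraph V) : ℕ :=
  sSup {k | ∃ M : G.Subgraph, M.IsMatching ∧ M.edgeSet.ncard = k}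

end SimpleGraph

namespace SimpleGraph

/-! In a cubic claw-free graph every vertex lies in a triangle. As `G` is not `K₄`, two triangles
that meet share exactly an edge and form a diamond, so the vertices split into units, each a
triangle or a diamond (`isUnitPartition_triangleEdgeGraph`). All three invariants are compared with
the number n of units.

If every unit is a triangle, then Z ≤ n + 1, α ≥ n and α' ≥ n + 1; if some unit is a diamond, then Z
≤ n + 2, α ≥ n + 1 and α' ≥ n + 2. Forcing spends three vertices on one unit and one on each further
unit, reached along an edge (`exists_forcing_units`); a final triangle costs nothing. Independent
sets take one vertex per unit, by Hall's theorem on the triangles (`exists_independent_choice`), and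
both ends of one diamond. Matchings take one edge per unit plus one or two extra edges
(`card_add_card_le_matchingNumber`). -/

variable {V Q : Type*} {G : SimpleGraph V} {u : V → Q}

/-! ### Criteria for zero forcing sets and matchings. -/

/-- A set of colored vertices in which no vertex can force a new one. -/
def ForcingClosed (G : SimpleGraph V) (C : Set V) : Prop :=
  ∀ v ∈ C, ∀ w, G.Adj v w → (∀ x, G.Adj v x → x ≠ w → x ∈ C) → w ∈ C

theorem subset_forcingStep (G : SimpleGraph V) (C : Set V) : C ⊆ G.forcingStep C :=
  Set.subset_union_left

theorem forcingClosed_of_forcingStep_eq {C : Set V} (h : G.forcingStep C = C) :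
    G.ForcingClosed C := by
  intro v hv w hvw hx
  by_contra hw
  apply hw
  rw [← h]
  refine Or.inr ⟨v, hv, ?_⟩
  ext x
  simp only [Set.mem_sdiff, mem_neighborSet, Set.mem_singleton_iff]
  constructor
  · rintro ⟨h1, h2⟩
    by_contra hne
    exact h2 (hx x h1 hne)
  · rintro rfl
    exact ⟨hvw, hw⟩

/-- The iterates increase, so in a finite graph they stabilize, and a stable set is closed. Forcing
arguments can then ignore time steps. -/
theorem isZeroForcingSet_of_forcingClosed [Finite V] {S : Set V}
    (h : ∀ C, S ⊆ C → G.ForcingClosed C → C = Set.univ) : G.IsZeroForcingSet S := by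
  have hmono : Monotone fun t => G.forcingStep^[t] S := by
    refine monotone_nat_of_le_succ fun t => ?_
    simp only [Function.iterate_succ_apply']
    exact subset_forcingStep G _
  obtain ⟨t, ht⟩ := WellFoundedGT.monotone_chain_condition ⟨_, hmono⟩
  refine ⟨t, h _ (hmono (Nat.zero_le t)) (forcingClosed_of_forcingStep_eq ?_)⟩
  have := ht (t + 1) (Nat.le_succ t)
  simp only [OrderHom.coe_mk, Function.iterate_succ_apply'] at this
  exact this.symm

theorem zeroForcingNumber_le_card [Finite V] {S : Finset V}
    (h : ∀ C : Set V, (S : Set V) ⊆ C → G.ForcingClosed C → C = Set.univ) :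
    G.zeroForcingNumber ≤ S.card :=
  Nat.sInf_le ⟨S, isZeroForcingSet_of_forcingClosed h, rfl⟩

theorem card_le_matchingNumber [Finite V] {E : Finset (Sym2 V)}
    (hE : (E : Set (Sym2 V)) ⊆ G.edgeSet)
    (hd : ∀ e ∈ E, ∀ f ∈ E, ∀ v, v ∈ e → v ∈ f → e = f) : E.card ≤ G.matchingNumber := by
  let M : G.Subgraph :=
    { verts := {v | ∃ e ∈ E, v ∈ e}
      Adj := fun v w => s(v, w) ∈ E
      adj_sub := fun h => hE h
      edge_vert := fun h => ⟨_, h, Sym2.mem_mk_left _ _⟩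
      symm := ⟨fun v w h => by rwa [Sym2.eq_swap]⟩ }
  have hM : M.IsMatching := by
    rintro v ⟨e, he, hv⟩
    obtain ⟨w, rfl⟩ := hv
    refine ⟨w, he, fun y hy => ?_⟩
    have := hd _ hy _ he v (Sym2.mem_mk_left _ _) (Sym2.mem_mk_left _ _)
    exact Sym2.congr_right.1 this
  have hset : M.edgeSet = E := by
    ext e
    induction e with | _ v w => rfl
  refine le_csSup ?_ ⟨M, hM, by rw [hset, Set.ncard_coe_finset]⟩
  refine ⟨Nat.card (Sym2 V), ?_⟩
  rintro k ⟨M, -, rfl⟩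
  exact Set.ncard_le_card _

/-! ### Local structure of cubic claw-free graphs. -/

/-- Every vertex has exactly three neighbors, in elementary form. -/
structure Cubic (G : SimpleGraph V) : Prop where
  exists_third : ∀ v a b, ∃ c, G.Adj v c ∧ c ≠ a ∧ c ≠ b
  eq_of_adj : ∀ v a b c w, G.Adj v a → G.Adj v b → G.Adj v c → a ≠ b → a ≠ c → b ≠ c →
    G.Adj v w → w = a ∨ w = b ∨ w = c

theorem IsRegularOfDegree.cubic [Fintype V] [DecidableRel G.Adj] (h : G.IsRegularOfDegree 3) :
    G.Cubic := by
  classical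
  have hc : ∀ v, (G.neighborFinset v).card = 3 := h
  refine ⟨fun v a b => ?_, fun v a b c w ha hb hc' hab hac hbc hw => ?_⟩
  · by_contra! hcon
    have hsub : G.neighborFinset v ⊆ {a, b} := by
      intro c hcv
      have := hcon c (by simpa using hcv)
      simp only [Finset.mem_insert, Finset.mem_singleton]
      tauto
    have := Finset.card_le_card hsub
    have := Finset.card_le_two (a := a) (b := b)
    have := hc v
    omega
  · have hsub : {a, b, c} ⊆ G.neighborFinset v := by
      intro x hx
      simp only [Finset.mem_insert, Finset.mem_singleton] at hx
      rcases hx with rfl | rfl | rfl <;> simpa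
    have h3 : ({a, b, c} : Finset V).card = 3 := Finset.card_eq_three.2 ⟨a, b, c, hab, hac, hbc, rfl⟩
    have heq := Finset.eq_of_subset_of_card_le hsub (by rw [h3, hc v])
    have : w ∈ ({a, b, c} : Finset V) := by rw [heq]; simpa
    simpa using this

theorem ClawFree.exists_adj (h : G.ClawFree) {v a b c : V} (ha : G.Adj v a) (hb : G.Adj v b)
    (hc : G.Adj v c) (hab : a ≠ b) (hac : a ≠ c) (hbc : b ≠ c) :
    G.Adj a b ∨ G.Adj a c ∨ G.Adj b c := by
  by_contra! hcon
  obtain ⟨h1, h2, h3⟩ := hcon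
  have h1' : ¬ G.Adj b a := fun h => h1 h.symm
  have h2' : ¬ G.Adj c a := fun h => h2 h.symm
  have h3' : ¬ G.Adj c b := fun h => h3 h.symm
  let φ : Fin 1 ⊕ Fin 3 → V := Sum.elim (fun _ => v) ![a, b, c]
  have hinj : φ.Injective := by
    rintro (x | x) (y | y) hxy
    · congr 1; exact Subsingleton.elim _ _
    · fin_cases y <;> simp [φ] at hxy <;> subst hxy <;> simp at ha hb hc
    · fin_cases x <;> simp [φ] at hxy <;> subst hxy <;> simp at ha hb hc
    · fin_cases x <;> fin_cases y <;> simp_all [φ]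
  have hadj : ∀ x y, G.Adj (φ x) (φ y) ↔ (completeBipartiteGraph (Fin 1) (Fin 3)).Adj x y := by
    rintro (x | x) (y | y)
    · simp [φ]
    · fin_cases y <;> simp [φ, ha, hb, hc]
    · fin_cases x <;> simp [φ, ha.symm, hb.symm, hc.symm]
    · fin_cases x <;> fin_cases y <;> simp [φ, h1, h2, h3, h1', h2', h3']
  exact h ⟨⟨⟨φ, hinj⟩, hadj _ _⟩⟩

theorem Connected.exists_adj_boundary (h : G.Connected) {s : Set V} {a b : V} (ha : a ∈ s)
    (hb : b ∉ s) : ∃ v w, G.Adj v w ∧ v ∈ s ∧ w ∉ s := by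
  obtain ⟨p⟩ := h.preconnected a b
  obtain ⟨d, -, h1, h2⟩ := p.exists_boundary_dart s ha hb
  exact ⟨d.fst, d.snd, d.adj, h1, h2⟩

/-- Four mutually adjacent vertices already have full degree, so no edge leaves them and by
connectedness they are the whole graph. -/
theorem Cubic.not_completeGraph_four [Finite V] (hG : G.Cubic) (hconn : G.Connected)
    (hK4 : IsEmpty (G ≃g completeGraph (Fin 4))) {a b c d : V} (hab : G.Adj a b)
    (hac : G.Adj a c) (had : G.Adj a d) (hbc : G.Adj b c) (hbd : G.Adj b d) :
    ¬ G.Adj c d := by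
  intro hcd
  have hall : ∀ v, v = a ∨ v = b ∨ v = c ∨ v = d := by
    by_contra! hcon
    obtain ⟨x, hx⟩ := hcon
    obtain ⟨v, w, hvw, hv, hw⟩ := hconn.exists_adj_boundary
      (s := {v | v = a ∨ v = b ∨ v = c ∨ v = d}) (Or.inl rfl) (by simpa using hx)
    apply hw
    rcases hv with rfl | rfl | rfl | rfl
    · have := hG.eq_of_adj _ b c d w hab hac had hbc.ne hbd.ne hcd.ne hvw
      tauto
    · have := hG.eq_of_adj _ a c d w hab.symm hbc hbd hac.ne had.ne hcd.ne hvw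
      tauto
    · have := hG.eq_of_adj _ a b d w hac.symm hbc.symm hcd hab.ne had.ne hbd.ne hvw
      tauto
    · have := hG.eq_of_adj _ a b c w had.symm hbd.symm hcd.symm hab.ne hac.ne hbc.ne hvw
      tauto
  have e : Fin 4 ≃ V := Equiv.ofBijective ![a, b, c, d] <| by
    constructor
    · intro i j hij
      have := hab.ne; have := hac.ne; have := had.ne; have := hbc.ne; have := hbd.ne
      have := hcd.ne
      fin_cases i <;> fin_cases j <;> simp_all
    · intro v
      rcases hall v with rfl | rfl | rfl | rfl
      exacts [⟨0, rfl⟩, ⟨1, rfl⟩, ⟨2, rfl⟩, ⟨3, rfl⟩]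
  refine hK4.false ⟨e.symm, fun {v w} => ?_⟩
  simp only [completeGraph, top_adj, ne_eq, EmbeddingLike.apply_eq_iff_eq]
  refine ⟨fun hne => ?_, fun h => h.ne⟩
  rcases hall v with rfl | rfl | rfl | rfl <;> rcases hall w with rfl | rfl | rfl | rfl <;>
    first | exact absurd rfl hne | assumption | (apply Adj.symm; assumption)

/-! ### The partition into triangles and diamonds. -/

/-- The vertices mapped to `q` are those of a triangle of `G`. -/
def IsTriangleUnit (G : SimpleGraph V) (u : V → Q) (q : Q) : Prop :=
  ∃ x y z, G.Adj x y ∧ G.Adj x z ∧ G.Adj y z ∧ ∀ v, u v = q ↔ v = x ∨ v = y ∨ v = z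

/-- The vertices mapped to `q` are `a, b, c, d`, inducing `K₄` minus the edge `ad`. -/
def IsDiamond (G : SimpleGraph V) (u : V → Q) (q : Q) (a b c d : V) : Prop :=
  G.Adj a b ∧ G.Adj a c ∧ G.Adj b c ∧ G.Adj b d ∧ G.Adj c d ∧ ¬ G.Adj a d ∧ a ≠ d ∧
    ∀ v, u v = q ↔ v = a ∨ v = b ∨ v = c ∨ v = d

/-- The vertices mapped to `q` induce a diamond of `G`. -/
def IsDiamondUnit (G : SimpleGraph V) (u : V → Q) (q : Q) : Prop :=
  ∃ a b c d, G.IsDiamond u q a b c d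

/-- `u` partitions the vertices into triangles and diamonds. -/
def IsUnitPartition (G : SimpleGraph V) (u : V → Q) : Prop :=
  ∀ q, G.IsTriangleUnit u q ∨ G.IsDiamondUnit u q

/-- The graph of the edges of `G` that lie in a triangle. -/
def triangleEdgeGraph (G : SimpleGraph V) : SimpleGraph V where
  Adj v w := G.Adj v w ∧ ∃ x, G.Adj v x ∧ G.Adj w x
  symm := ⟨fun _ _ ⟨h, x, h1, h2⟩ => ⟨h.symm, x, h2, h1⟩⟩
  loopless := ⟨fun v h => G.loopless.irrefl v h.1⟩

theorem connectedComponentMk_eq_iff_mem {H : SimpleGraph V} {s : Set V} {a : V}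
    (ha : a ∈ s) (hr : ∀ v ∈ s, H.Reachable v a) (hs : ∀ v ∈ s, ∀ w, H.Adj v w → w ∈ s)
    (v : V) : H.connectedComponentMk v = H.connectedComponentMk a ↔ v ∈ s := by
  rw [ConnectedComponent.eq]
  refine ⟨fun ⟨p⟩ => ?_, hr v⟩
  by_contra hv
  obtain ⟨d, -, h1, h2⟩ := p.reverse.exists_boundary_dart s ha hv
  exact h2 (hs _ h1 _ d.adj)

theorem isUnitPartition_triangleEdgeGraph (hG : G.Cubic) (hclaw : G.ClawFree)
    (hK : ∀ a b c d, G.Adj a b → G.Adj a c → G.Adj a d → G.Adj b c → G.Adj b d → ¬ G.Adj c d) :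
    G.IsUnitPartition G.triangleEdgeGraph.connectedComponentMk := by
  -- a diamond is a whole component
  have hdia : ∀ a b c d, G.Adj a b → G.Adj a c → G.Adj b c → G.Adj b d → G.Adj c d → a ≠ d →
      ∀ v, v = a ∨ v = b ∨ v = c ∨ v = d →
      G.IsDiamondUnit G.triangleEdgeGraph.connectedComponentMk
        (G.triangleEdgeGraph.connectedComponentMk v) := by
    intro a b c d hab hac hbc hbd hcd had v hv
    have hnad : ¬ G.Adj a d := hK b c a d hbc hab.symm hbd hac.symm hcd
    have r1 : G.triangleEdgeGraph.Reachable b a := Adj.reachable ⟨hab.symm, c, hbc, hac⟩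
    have r2 : G.triangleEdgeGraph.Reachable c a := Adj.reachable ⟨hac.symm, b, hbc.symm, hab⟩
    have r3 : G.triangleEdgeGraph.Reachable d a :=
      (Adj.reachable (G := G.triangleEdgeGraph) ⟨hbd.symm, c, hcd.symm, hbc⟩).trans r1
    have key := connectedComponentMk_eq_iff_mem (H := G.triangleEdgeGraph) (a := a)
      (s := {v | v = a ∨ v = b ∨ v = c ∨ v = d}) (Or.inl rfl)
      (by rintro v (rfl | rfl | rfl | rfl) <;> first | assumption | exact Reachable.refl _)
      (by
        have nb := fun w => hG.eq_of_adj b a c d w hab.symm hbc hbd hac.ne had hcd.ne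
        have nc := fun w => hG.eq_of_adj c a b d w hac.symm hbc.symm hcd hab.ne had hbd.ne
        -- An edge leaving the diamond starts at `a` or `d`. The third vertex of a triangle on it
        -- would be `b` or `c`, whose neighbors all lie in the diamond.
        rintro v hv w ⟨hvw, x, hvx, hwx⟩
        by_contra hw
        have hw' : w ≠ a ∧ w ≠ b ∧ w ≠ c ∧ w ≠ d := by simpa using hw
        rcases hv with rfl | rfl | rfl | rfl
        · have := hG.eq_of_adj v b c w x hab hac hvw hbc.ne hw'.2.1.symm hw'.2.2.1.symm hvx
          rcases this with rfl | rfl | rfl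
          · have := nb w hwx.symm; tauto
          · have := nc w hwx.symm; tauto
          · exact hwx.ne rfl
        · have := nb w hvw; tauto
        · have := nc w hvw; tauto
        · have := hG.eq_of_adj v b c w x hbd.symm hcd.symm hvw hbc.ne hw'.2.1.symm
            hw'.2.2.1.symm hvx
          rcases this with rfl | rfl | rfl
          · have := nb w hwx.symm; tauto
          · have := nc w hwx.symm; tauto
          · exact hwx.ne rfl)
    have hva := (key v).2 hv
    exact ⟨a, b, c, d, hab, hac, hbc, hbd, hcd, hnad, had, fun w => hva ▸ key w⟩
  refine fun q => q.ind fun v => ?_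
  have htri : ∃ x y, G.Adj v x ∧ G.Adj v y ∧ G.Adj x y := by
    obtain ⟨a, ha, -⟩ := hG.exists_third v v v
    obtain ⟨b, hb, hba, -⟩ := hG.exists_third v a v
    obtain ⟨c, hc, hca, hcb⟩ := hG.exists_third v a b
    rcases hclaw.exists_adj ha hb hc hba.symm hca.symm hcb.symm with h | h | h
    exacts [⟨a, b, ha, hb, h⟩, ⟨a, c, ha, hc, h⟩, ⟨b, c, hb, hc, h⟩]
  obtain ⟨x, y, hx, hy, hxy⟩ := htri
  -- A second triangle on any side of `v x y` gives a diamond; otherwise the triangle is a whole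
  -- component.
  by_cases h1 : ∃ s, G.Adj v s ∧ G.Adj x s ∧ s ≠ y
  · obtain ⟨s, hs1, hs2, hs3⟩ := h1
    exact Or.inr (hdia y v x s hy.symm hxy.symm hx hs1 hs2 hs3.symm v (by simp))
  by_cases h2 : ∃ s, G.Adj v s ∧ G.Adj y s ∧ s ≠ x
  · obtain ⟨s, hs1, hs2, hs3⟩ := h2
    exact Or.inr (hdia x v y s hx.symm hxy hy hs1 hs2 hs3.symm v (by simp))
  by_cases h3 : ∃ s, G.Adj x s ∧ G.Adj y s ∧ s ≠ v
  · obtain ⟨s, hs1, hs2, hs3⟩ := h3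
    exact Or.inr (hdia v x y s hx hy hxy hs1 hs2 hs3.symm v (by simp))
  push Not at h1 h2 h3
  refine Or.inl ⟨v, x, y, hx, hy, hxy, fun w => ?_⟩
  refine connectedComponentMk_eq_iff_mem (H := G.triangleEdgeGraph) (a := v)
      (s := {w | w = v ∨ w = x ∨ w = y}) (Or.inl rfl) ?_ ?_ w
  · rintro w (rfl | rfl | rfl)
    · exact Reachable.refl _
    · exact Adj.reachable ⟨hx.symm, y, hxy, hy⟩
    · exact Adj.reachable ⟨hy.symm, x, hxy.symm, hx⟩
  · rintro p hp w ⟨hpw, s, hps, hws⟩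
    by_contra hw
    have hw' : w ≠ v ∧ w ≠ x ∧ w ≠ y := by simpa using hw
    obtain ⟨w1, w2, w3⟩ := hw'
    rcases hp with rfl | rfl | rfl
    · rcases hG.eq_of_adj p x y w s hx hy hpw hxy.ne w2.symm w3.symm hps with rfl | rfl | rfl
      · exact w3 (h1 w hpw hws.symm)
      · exact w2 (h2 w hpw hws.symm)
      · exact hws.ne rfl
    · rcases hG.eq_of_adj p v y w s hx.symm hxy hpw hy.ne w1.symm w3.symm hps with rfl | rfl | rfl
      · exact w3 (h1 w hws.symm hpw)
      · exact w1 (h3 w hpw hws.symm)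
      · exact hws.ne rfl
    · rcases hG.eq_of_adj p v x w s hy.symm hxy.symm hpw hx.ne w1.symm w2.symm hps with
        rfl | rfl | rfl
      · exact w2 (h2 w hws.symm hpw)
      · exact w1 (h3 w hws.symm hpw)
      · exact hws.ne rfl

/-! ### Edges between units. -/

theorem IsTriangleUnit.exists_mates {q : Q} (h : G.IsTriangleUnit u q) {w : V} (hw : u w = q) :
    ∃ y z, G.Adj w y ∧ G.Adj w z ∧ G.Adj y z ∧ ∀ v, u v = q ↔ v = w ∨ v = y ∨ v = z := by
  obtain ⟨x, y, z, hxy, hxz, hyz, h⟩ := h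
  rcases (h w).1 hw with rfl | rfl | rfl
  · exact ⟨y, z, hxy, hxz, hyz, h⟩
  · exact ⟨x, z, hxy.symm, hyz, hxz, fun v => by rw [h v]; tauto⟩
  · exact ⟨x, y, hxz.symm, hyz.symm, hxy, fun v => by rw [h v]; tauto⟩

theorem IsDiamond.swap {q : Q} {a b c d : V} (h : G.IsDiamond u q a b c d) :
    G.IsDiamond u q d b c a := by
  obtain ⟨hab, hac, hbc, hbd, hcd, had, hne, h⟩ := h
  exact ⟨hbd.symm, hcd.symm, hbc, hab.symm, hac.symm, fun h => had h.symm, hne.symm,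
    fun v => by rw [h v]; tauto⟩

theorem IsDiamond.eq_or_eq_of_adj (hG : G.Cubic) {q : Q} {a b c d v w : V}
    (h : G.IsDiamond u q a b c d) (hv : u v = q) (hvw : G.Adj v w) (hw : u w ≠ q) :
    v = a ∨ v = d := by
  obtain ⟨hab, hac, hbc, hbd, hcd, -, hne, h⟩ := h
  rw [ne_eq, h w] at hw
  rcases (h v).1 hv with rfl | rfl | rfl | rfl
  · simp
  · have := hG.eq_of_adj v a c d w hab.symm hbc hbd hac.ne hne hcd.ne hvw
    tauto
  · have := hG.eq_of_adj v a b d w hac.symm hbc.symm hcd hab.ne hne hbd.ne hvw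
    tauto
  · simp

theorem IsDiamondUnit.exists_isDiamond_of_adj (hG : G.Cubic) {q : Q} {v w : V}
    (h : G.IsDiamondUnit u q) (hv : u v = q) (hvw : G.Adj v w) (hw : u w ≠ q) :
    ∃ b c d, G.IsDiamond u q v b c d := by
  obtain ⟨a, b, c, d, h⟩ := h
  rcases h.eq_or_eq_of_adj hG hv hvw hw with rfl | rfl
  exacts [⟨b, c, d, h⟩, ⟨b, c, a, h.swap⟩]

theorem IsUnitPartition.exists_two_mates (hG : G.Cubic) (hu : G.IsUnitPartition u) {v w : V}
    (hvw : G.Adj v w) (hw : u w ≠ u v) :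
    ∃ y z, y ≠ z ∧ G.Adj v y ∧ G.Adj v z ∧ u y = u v ∧ u z = u v := by
  rcases hu (u v) with h | h
  · obtain ⟨y, z, hy, hz, hyz, h⟩ := h.exists_mates rfl
    exact ⟨y, z, hyz.ne, hy, hz, (h y).2 (by simp), (h z).2 (by simp)⟩
  · obtain ⟨y, z, d, hy, hz, hyz, -, -, -, -, h⟩ := h.exists_isDiamond_of_adj hG rfl hvw hw
    exact ⟨y, z, hyz.ne, hy, hz, (h y).2 (by simp), (h z).2 (by simp)⟩

theorem IsUnitPartition.eq_or_eq_of_adj (hG : G.Cubic) (hu : G.IsUnitPartition u) {v w x : V}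
    (hvw : G.Adj v w) (hw : u w ≠ u v) (hvx : G.Adj v x) : x = w ∨ u x = u v := by
  obtain ⟨y, z, hyz, hy, hz, huy, huz⟩ := hu.exists_two_mates hG hvw hw
  have h1 : y ≠ w := by rintro rfl; exact hw huy
  have h2 : z ≠ w := by rintro rfl; exact hw huz
  rcases hG.eq_of_adj v y z w x hy hz hvw hyz h1 h2 hvx with rfl | rfl | rfl
  exacts [Or.inr huy, Or.inr huz, Or.inl rfl]

theorem IsUnitPartition.outer_unique (hG : G.Cubic) (hu : G.IsUnitPartition u) {v w x : V}
    (hvw : G.Adj v w) (hw : u w ≠ u v) (hvx : G.Adj v x) (hx : u x ≠ u v) : x = w :=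
  (hu.eq_or_eq_of_adj hG hvw hw hvx).resolve_right hx

theorem IsTriangleUnit.exists_outer (hG : G.Cubic) {q : Q} (h : G.IsTriangleUnit u q) {v : V}
    (hv : u v = q) : ∃ w, G.Adj v w ∧ u w ≠ q := by
  obtain ⟨y, z, -, -, -, h⟩ := h.exists_mates hv
  obtain ⟨w, hw, hy, hz⟩ := hG.exists_third v y z
  exact ⟨w, hw, fun hq => by have := (h w).1 hq; have := hw.ne; tauto⟩

theorem IsDiamond.exists_outer (hG : G.Cubic) {q : Q} {a b c d : V}
    (h : G.IsDiamond u q a b c d) : ∃ w, G.Adj a w ∧ u w ≠ q := by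
  obtain ⟨-, -, -, -, -, had, -, h⟩ := h
  obtain ⟨w, hw, hy, hz⟩ := hG.exists_third a b c
  refine ⟨w, hw, fun hq => ?_⟩
  rcases (h w).1 hq with rfl | rfl | rfl | rfl
  exacts [hw.ne rfl, hy rfl, hz rfl, had hw]

theorem IsUnitPartition.exists_outer (hG : G.Cubic) (hu : G.IsUnitPartition u) (q : Q) :
    ∃ v w, u v = q ∧ G.Adj v w ∧ u w ≠ q := by
  rcases hu q with h | ⟨a, b, c, d, h⟩
  · obtain ⟨x, y, z, -, -, -, h'⟩ := id h
    obtain ⟨w, hw⟩ := h.exists_outer hG ((h' x).2 (by simp))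
    exact ⟨x, w, (h' x).2 (by simp), hw⟩
  · obtain ⟨w, hw⟩ := h.exists_outer hG
    exact ⟨a, w, (h.2.2.2.2.2.2.2 a).2 (by simp), hw⟩

/-! ### Zero forcing -/

theorem IsUnitPartition.exists_forcing_unit (hG : G.Cubic) (hu : G.IsUnitPartition u) (q : Q) :
    ∃ S : Finset V, S.card ≤ 3 ∧
      ∀ C : Set V, G.ForcingClosed C → (S : Set V) ⊆ C → ∀ p, u p = q → p ∈ C := by
  classical
  rcases hu q with ⟨x, y, z, -, -, -, h⟩ | ⟨a, b, c, d, hab, hac, hbc, hbd, hcd, -, had, h⟩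
  · refine ⟨{x, y, z}, Finset.card_le_three, fun C _ hS p hp => hS ?_⟩
    simpa using (h p).1 hp
  · refine ⟨{a, b, c}, Finset.card_le_three, fun C hC hS p hp => ?_⟩
    have ha : a ∈ C := hS (by simp)
    have hb : b ∈ C := hS (by simp)
    have hc : c ∈ C := hS (by simp)
    rcases (h p).1 hp with rfl | rfl | rfl | rfl
    · exact ha
    · exact hb
    · exact hc
    · refine hC b hb p hbd fun x hx hxd => ?_
      rcases hG.eq_of_adj b a c p x hab.symm hbc hbd hac.ne had hcd.ne hx with rfl | rfl | rfl
      exacts [ha, hc, absurd rfl hxd]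

/-- All neighbors of `v` other than `w` are in its own unit, so `v` forces `w`. Coloring one mate
`s` of `w` lets `w` force its other mate; in a diamond, `s` then forces the far end. -/
theorem IsUnitPartition.exists_forcing_next (hG : G.Cubic) (hu : G.IsUnitPartition u) {v w : V}
    (hvw : G.Adj v w) (hw : u w ≠ u v) :
    ∃ s, ∀ C : Set V, G.ForcingClosed C → (∀ p, u p = u v → p ∈ C) → s ∈ C →
      ∀ p, u p = u w → p ∈ C := by
  have force : ∀ C : Set V, G.ForcingClosed C → (∀ p, u p = u v → p ∈ C) → w ∈ C := by
    intro C hC hv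
    refine hC v (hv v rfl) w hvw fun x hx hxw => ?_
    exact hv x ((hu.eq_or_eq_of_adj hG hvw hw hx).resolve_left hxw)
  have hwv : ∀ x, u x = u w → x ≠ v := by
    rintro x hx rfl
    exact hw hx.symm
  rcases hu (u w) with h | h
  · obtain ⟨y, z, hwy, hwz, hyz, h⟩ := h.exists_mates rfl
    refine ⟨y, fun C hC hv hy p hp => ?_⟩
    have hwC := force C hC hv
    rcases (h p).1 hp with rfl | rfl | rfl
    · exact hwC
    · exact hy
    · refine hC w hwC p hwz fun x hx hxp => ?_
      rcases hG.eq_of_adj w y p v x hwy hwz hvw.symm hyz.ne (hwv y ((h y).2 (by simp)))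
        (hwv p hp) hx with rfl | rfl | rfl
      exacts [hy, absurd rfl hxp, hv x rfl]
  · obtain ⟨b, c, d, hwb, hwc, hbc, hbd, hcd, -, hwd, h⟩ :=
      h.exists_isDiamond_of_adj hG rfl hvw.symm hw.symm
    refine ⟨b, fun C hC hv hb => ?_⟩
    have hwC := force C hC hv
    have hc : c ∈ C := by
      refine hC w hwC c hwc fun x hx hxp => ?_
      rcases hG.eq_of_adj w b c v x hwb hwc hvw.symm hbc.ne (hwv b ((h b).2 (by simp)))
        (hwv c ((h c).2 (by simp))) hx with rfl | rfl | rfl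
      exacts [hb, absurd rfl hxp, hv x rfl]
    have hd : d ∈ C := by
      refine hC b hb d hbd fun x hx hxp => ?_
      rcases hG.eq_of_adj b w c d x hwb.symm hbc hbd hwc.ne hwd hcd.ne hx with rfl | rfl | rfl
      exacts [hwC, hc, absurd rfl hxp]
    intro p hp
    rcases (h p).1 hp with rfl | rfl | rfl | rfl <;> assumption

theorem IsUnitPartition.exists_forcing_units [Finite V] [Fintype Q] (hG : G.Cubic)
    (hconn : G.Connected) (hu : G.IsUnitPartition u) {k : ℕ} (hk : 1 ≤ k)
    (hkQ : k ≤ Fintype.card Q) :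
    ∃ U : Finset Q, U.card = k ∧ ∃ S : Finset V, S.card ≤ k + 2 ∧
      ∀ C : Set V, G.ForcingClosed C → (S : Set V) ⊆ C → ∀ p, u p ∈ U → p ∈ C := by
  classical
  induction k, hk using Nat.le_induction with
  | base =>
    obtain ⟨q⟩ := Fintype.card_pos_iff.1 hkQ
    obtain ⟨S, hS, h⟩ := hu.exists_forcing_unit hG q
    exact ⟨{q}, Finset.card_singleton q, S, hS, fun C hC hSC p hp =>
      h C hC hSC p (Finset.mem_singleton.1 hp)⟩
  | succ k hk ih =>
    obtain ⟨U, hU, S, hS, h⟩ := ih (by omega)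
    obtain ⟨q, hq⟩ := Finset.card_pos.1 (by omega : 0 < U.card)
    obtain ⟨r, hr⟩ : ∃ r, r ∉ U := by
      by_contra! hcon
      have := Finset.card_eq_iff_eq_univ U |>.2 (Finset.eq_univ_iff_forall.2 hcon)
      omega
    obtain ⟨a, -, rfl, -⟩ := hu.exists_outer hG q
    obtain ⟨b, -, rfl, -⟩ := hu.exists_outer hG r
    obtain ⟨v, w, hvw, hv, hw⟩ := hconn.exists_adj_boundary (s := {v | u v ∈ U}) hq hr
    obtain ⟨s, hs⟩ := hu.exists_forcing_next hG hvw (by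
      intro heq
      exact hw (by simpa [heq] using hv))
    refine ⟨insert (u w) U, by rw [Finset.card_insert_of_notMem hw, hU], insert s S,
      (Finset.card_insert_le _ _).trans (by omega), fun C hC hSC p hp => ?_⟩
    rw [Finset.coe_insert, Set.insert_subset_iff] at hSC
    rcases Finset.mem_insert.1 hp with hp | hp
    · exact hs C hC (fun x hx => h C hC hSC.2 x (hx ▸ hv)) hSC.1 p hp
    · exact h C hC hSC.2 p hp

theorem IsUnitPartition.zeroForcingNumber_le [Finite V] [Fintype Q] (hG : G.Cubic)
    (hconn : G.Connected) (hu : G.IsUnitPartition u) :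
    G.zeroForcingNumber ≤ Fintype.card Q + 2 := by
  have : Nonempty Q := hconn.nonempty.map u
  obtain ⟨U, hU, S, hS, h⟩ :=
    hu.exists_forcing_units hG hconn (k := Fintype.card Q) Fintype.card_pos le_rfl
  refine le_trans (zeroForcingNumber_le_card fun C hSC hC => ?_) hS
  refine Set.eq_univ_of_forall fun p => h C hC hSC p ?_
  rw [(Finset.card_eq_iff_eq_univ U).1 hU]
  exact Finset.mem_univ _

/-- Once all units but one are colored, each vertex of the last triangle is forced by its own
neighbor outside. This fails for the middle vertices of a diamond. -/
theorem IsUnitPartition.zeroForcingNumber_le_of_triangles [Finite V] [Fintype Q] (hG : G.Cubic)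
    (hconn : G.Connected) (hu : G.IsUnitPartition u) (ht : ∀ q, G.IsTriangleUnit u q) :
    G.zeroForcingNumber ≤ Fintype.card Q + 1 := by
  classical
  have hcard : 1 < Fintype.card Q := by
    obtain ⟨p⟩ := hconn.nonempty
    obtain ⟨v, w, hv, -, hw⟩ := hu.exists_outer hG (u p)
    exact Fintype.one_lt_card_iff.2 ⟨_, _, hw⟩
  obtain ⟨U, hU, S, hS, h⟩ :=
    hu.exists_forcing_units hG hconn (k := Fintype.card Q - 1) (by omega) (by omega)
  refine le_trans (zeroForcingNumber_le_card fun C hSC hC => ?_) (hS.trans (by omega))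
  refine Set.eq_univ_of_forall fun p => ?_
  by_cases hp : u p ∈ U
  · exact h C hC hSC p hp
  obtain ⟨w, hpw, hw⟩ := (ht (u p)).exists_outer hG rfl
  have hwU : u w ∈ U := by
    by_contra hwU
    have h1 : Uᶜ.card = 1 := by rw [Finset.card_compl]; omega
    exact hw (Finset.card_le_one.1 h1.le _ (Finset.mem_compl.2 hwU) _ (Finset.mem_compl.2 hp))
  refine hC w (h C hC hSC w hwU) p hpw.symm fun x hx hxp => ?_
  refine h C hC hSC x ?_
  rwa [(hu.eq_or_eq_of_adj hG hpw.symm hw.symm hx).resolve_left hxp]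

/-! ### Independent sets -/

/-- Hall's theorem assigns distinct outer edges to the triangles. Choosing in each triangle an end
of its edge gives an independent set, since two adjacent choices would share their outer edge. The
count leaves room to forbid two vertices. -/
theorem IsUnitPartition.exists_independent_choice [Finite V] [Finite Q] (hG : G.Cubic)
    (hu : G.IsUnitPartition u) (B : Finset V) (hB : B.card ≤ 2) :
    ∃ f : {q // G.IsTriangleUnit u q} → V, (∀ q, u (f q) = q) ∧ (∀ q, f q ∉ B) ∧
      ∀ q r, ¬ G.Adj (f q) (f r) := by
  classical
  have := Fintype.ofFinite V
  have ho : ∀ v, ∃ w, G.IsTriangleUnit u (u v) → G.Adj v w ∧ u w ≠ u v := by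
    intro v
    by_cases h : G.IsTriangleUnit u (u v)
    · obtain ⟨w, hw⟩ := h.exists_outer hG rfl
      exact ⟨w, fun _ => hw⟩
    · exact ⟨v, fun h' => absurd h' h⟩
  choose o ho using ho
  let T : {q // G.IsTriangleUnit u q} → Finset V := fun q => Finset.univ.filter fun v => u v = q
  have hT : ∀ q, (T q).card = 3 := by
    rintro ⟨q, hq⟩
    obtain ⟨x, y, z, hxy, hxz, hyz, h⟩ := id hq
    refine Finset.card_eq_three.2 ⟨x, y, z, hxy.ne, hxz.ne, hyz.ne, ?_⟩
    ext v
    simp [T, h]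
  have hall : ∀ s : Finset {q // G.IsTriangleUnit u q},
      s.card ≤ (s.biUnion fun q => (T q \ B).image fun v => s(v, o v)).card := by
    intro s
    rcases s.eq_empty_or_nonempty with rfl | hs
    · simp
    have hs := hs.card_pos
    have h1 : (s.biUnion T).card = s.card * 3 := by
      rw [Finset.card_biUnion, Finset.sum_const_nat fun q _ => hT q]
      intro q _ r _ hqr
      refine Finset.disjoint_left.2 fun v hv hv' => hqr (Subtype.ext ?_)
      simp only [T, Finset.mem_filter, Finset.mem_univ, true_and] at hv hv'
      exact hv.symm.trans hv'
    have h2 := Finset.le_card_sdiff B (s.biUnion T)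
    -- An edge arises from at most two vertices, so s triangles meet m edges with 3s - 2 ≤ 2m,
    -- whence s ≤ m for s ≥ 1.
    have h3 : (s.biUnion T \ B).card ≤
        2 * ((s.biUnion T \ B).image fun v => s(v, o v)).card := by
      refine Finset.card_le_mul_card_image _ 2 fun e he => ?_
      obtain ⟨v, -, rfl⟩ := Finset.mem_image.1 he
      refine (Finset.card_le_card (t := {v, o v}) fun x hx => ?_).trans Finset.card_le_two
      have hx := (Finset.mem_filter.1 hx).2
      have : x ∈ s(v, o v) := hx ▸ Sym2.mem_mk_left _ _
      simpa using this
    have h4 : (s.biUnion fun q => (T q \ B).image fun v => s(v, o v)) =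
        (s.biUnion T \ B).image fun v => s(v, o v) := by
      ext e
      simp only [Finset.mem_biUnion, Finset.mem_image, Finset.mem_sdiff]
      constructor
      · rintro ⟨q, hq, v, ⟨hv, hvB⟩, rfl⟩
        exact ⟨v, ⟨⟨q, hq, hv⟩, hvB⟩, rfl⟩
      · rintro ⟨v, ⟨⟨q, hq, hv⟩, hvB⟩, rfl⟩
        exact ⟨q, hq, v, ⟨hv, hvB⟩, rfl⟩
    rw [h4]
    omega
  obtain ⟨e, hinj, he⟩ := (Finset.all_card_le_biUnion_card_iff_exists_injective _).1 hall
  simp only [Finset.mem_image, Finset.mem_sdiff] at he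
  choose f hf hfe using he
  have hfu : ∀ q, u (f q) = q := fun q => by simpa [T] using (hf q).1
  have hout : ∀ q r, G.Adj (f q) (f r) → q ≠ r → f r = o (f q) := by
    intro q r hadj hqr
    have h := ho (f q) (by rw [hfu]; exact q.2)
    refine hu.outer_unique hG h.1 h.2 hadj ?_
    rw [hfu, hfu]
    exact fun h => hqr (Subtype.ext h.symm)
  refine ⟨f, hfu, fun q => (hf q).2, fun q r hadj => ?_⟩
  have hqr : q ≠ r := by
    rintro rfl
    exact hadj.ne rfl
  refine hqr (hinj ?_)
  rw [← hfe q, ← hfe r, ← hout q r hadj hqr, ← hout r q hadj.symm hqr.symm, Sym2.eq_swap]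

theorem card_le_indepNum_of_injective [Fintype V] {ι : Type*} [Fintype ι] {f : ι → V}
    (hf : f.Injective) (h : ∀ i j, ¬ G.Adj (f i) (f j)) : Fintype.card ι ≤ G.indepNum := by
  classical
  rw [← Finset.card_univ, ← Finset.card_image_of_injective _ hf]
  refine IsIndepSet.card_le_indepNum ?_
  intro x hx y hy _
  obtain ⟨i, -, rfl⟩ := Finset.mem_image.1 hx
  obtain ⟨j, -, rfl⟩ := Finset.mem_image.1 hy
  exact h i j

theorem IsUnitPartition.card_le_indepNum [Fintype V] [Fintype Q] (hG : G.Cubic)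
    (hu : G.IsUnitPartition u) (ht : ∀ q, G.IsTriangleUnit u q) :
    Fintype.card Q ≤ G.indepNum := by
  obtain ⟨f, hf, -, hadj⟩ := hu.exists_independent_choice hG ∅ (by simp)
  refine card_le_indepNum_of_injective (f := fun q => f ⟨q, ht q⟩) ?_ fun q r => hadj _ _
  intro q r hqr
  simpa [hf] using congrArg u hqr

/-- The diamond contributes both ends `a` and `d`. The triangle choices avoid their outer neighbors,
which is why two vertices are forbidden. -/
theorem IsUnitPartition.card_lt_indepNum [Fintype V] [Fintype Q] (hG : G.Cubic)
    (hu : G.IsUnitPartition u) {q : Q} (hq : G.IsDiamondUnit u q) :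
    Fintype.card Q + 1 ≤ G.indepNum := by
  classical
  obtain ⟨a, b, c, d, hD⟩ := hq
  obtain ⟨a', haa', ha'⟩ := hD.exists_outer hG
  obtain ⟨d', hdd', hd'⟩ := hD.swap.exists_outer hG
  obtain ⟨f, hf, hfB, hadj⟩ := hu.exists_independent_choice hG {a', d'} Finset.card_le_two
  obtain ⟨-, -, -, -, -, had, hne, hD⟩ := hD
  have hua : u a = q := (hD a).2 (by simp)
  have hud : u d = q := (hD d).2 (by simp)
  -- Any other diamond contributes a middle vertex, which has no neighbor outside its unit.
  have hg : ∀ r, ∃ v, u v = r ∧ ((r = q ∧ v = a) ∨ (r ≠ q ∧ ∃ h, v = f ⟨r, h⟩) ∨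
      (r ≠ q ∧ ∀ w, G.Adj v w → u w = r)) := by
    intro r
    by_cases hr : r = q
    · exact ⟨a, by rw [hr, hua], Or.inl ⟨hr, rfl⟩⟩
    rcases hu r with h | ⟨x, y, z, w, h⟩
    · exact ⟨f ⟨r, h⟩, hf _, Or.inr (Or.inl ⟨hr, h, rfl⟩)⟩
    · have huy : u y = r := (h.2.2.2.2.2.2.2 y).2 (by simp)
      refine ⟨y, huy, Or.inr (Or.inr ⟨hr, fun p hp => ?_⟩)⟩
      by_contra hpr
      rcases h.eq_or_eq_of_adj hG huy hp hpr with h' | h'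
      · exact h.1.ne h'.symm
      · exact h.2.2.2.1.ne h'
  choose g hgu hg using hg
  have key : ∀ v v' r, (∀ w, G.Adj v w → u w ≠ q → w = v') → v' ∈ ({a', d'} : Finset V) →
      r ≠ q → u v = q → ¬ G.Adj v (g r) := by
    intro v v' r hv hv' hr huv hvr
    rcases hg r with h | ⟨-, h, hgr⟩ | ⟨-, h⟩
    · exact hr h.1
    · refine hfB ⟨r, h⟩ ?_
      rw [← hgr, hv (g r) hvr (by rwa [hgu])]
      exact hv'
    · exact hr ((h v hvr.symm).symm.trans huv)
  have ha : ∀ r, r ≠ q → ¬ G.Adj a (g r) := fun r hr =>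
    key a a' r (fun w hw hwq => hu.outer_unique hG haa' (by rwa [hua]) hw (by rwa [hua]))
      (by simp) hr hua
  have hd : ∀ r, ¬ G.Adj d (g r) := by
    intro r
    by_cases hr : r = q
    · rcases hg r with h | h | h
      · rw [h.2]; exact fun h => had h.symm
      · exact absurd hr h.1
      · exact absurd hr h.1
    · exact key d d' r (fun w hw hwq => hu.outer_unique hG hdd' (by rwa [hud]) hw (by rwa [hud]))
        (by simp) hr hud
  have hgg : ∀ r t, ¬ G.Adj (g r) (g t) := by
    intro r t hrt
    have hne' : r ≠ t := by
      rintro rfl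
      exact hrt.ne rfl
    rcases hg r with ⟨rfl, h⟩ | ⟨hr, h, hgr⟩ | ⟨-, h⟩
    · exact ha t hne'.symm (h ▸ hrt)
    · rcases hg t with ⟨rfl, h'⟩ | ⟨ht, h', hgt⟩ | ⟨-, h'⟩
      · exact ha r hne' (h' ▸ hrt.symm)
      · rw [hgr, hgt] at hrt
        exact hadj _ _ hrt
      · exact hne' ((hgu r).symm.trans (h' _ hrt.symm))
    · exact hne' ((h _ hrt).symm.trans (hgu t))
  have hdg : ∀ r, d ≠ g r := by
    intro r hr
    have hrq : r = q := by rw [← hgu r, ← hr, hud]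
    rcases hg r with h | h | h
    · exact hne (h.2.symm.trans hr.symm)
    · exact h.1 hrq
    · exact h.1 hrq
  rw [← Fintype.card_option]
  refine card_le_indepNum_of_injective (f := fun r : Option Q => r.elim d g) ?_ ?_
  · rintro (_ | r) (_ | t) h
    · rfl
    · exact absurd h (hdg t)
    · exact absurd h.symm (hdg r)
    · have : g r = g t := h
      rw [← hgu r, this, hgu]
  · rintro (_ | r) (_ | t)
    · exact fun h => h.ne rfl
    · exact hd t
    · exact fun h => hd r h.symm
    · exact hgg r t

/-! ### Matchings -/

theorem card_add_card_le_matchingNumber [Finite V] [Fintype Q] (X : Finset (Sym2 V))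
    (hX : (X : Set (Sym2 V)) ⊆ G.edgeSet)
    (hd : ∀ e ∈ X, ∀ f ∈ X, ∀ v, v ∈ e → v ∈ f → e = f)
    (h : ∀ q, ∃ e ∈ G.edgeSet, ∀ v ∈ e, u v = q ∧ ∀ x ∈ X, v ∉ x) :
    Fintype.card Q + X.card ≤ G.matchingNumber := by
  classical
  choose e he hv using h
  have hmem : ∀ f : Sym2 V, ∃ v, v ∈ f := fun f => f.ind fun v w => ⟨v, Sym2.mem_mk_left _ _⟩
  have hinj : e.Injective := by
    intro q r hqr
    obtain ⟨v, hve⟩ := hmem (e q)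
    rw [← (hv q v hve).1, (hv r v (hqr ▸ hve)).1]
  have hdisj : Disjoint (Finset.univ.image e) X := by
    refine Finset.disjoint_left.2 fun f hf hfX => ?_
    obtain ⟨q, -, rfl⟩ := Finset.mem_image.1 hf
    obtain ⟨v, hve⟩ := hmem (e q)
    exact (hv q v hve).2 _ hfX hve
  rw [← Finset.card_univ, ← Finset.card_image_of_injective _ hinj,
    ← Finset.card_union_of_disjoint hdisj]
  refine card_le_matchingNumber ?_ ?_
  · intro f hf
    rcases Finset.mem_union.1 hf with hf | hf
    · obtain ⟨q, -, rfl⟩ := Finset.mem_image.1 hf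
      exact he q
    · exact hX hf
  · intro f hf f' hf' v hvf hvf'
    rcases Finset.mem_union.1 hf with hf | hf <;> rcases Finset.mem_union.1 hf' with hf' | hf'
    · obtain ⟨q, -, rfl⟩ := Finset.mem_image.1 hf
      obtain ⟨r, -, rfl⟩ := Finset.mem_image.1 hf'
      rw [← (hv q v hvf).1, (hv r v hvf').1]
    · obtain ⟨q, -, rfl⟩ := Finset.mem_image.1 hf
      exact absurd hvf' ((hv q v hvf).2 _ hf')
    · obtain ⟨q, -, rfl⟩ := Finset.mem_image.1 hf'
      exact absurd hvf ((hv q v hvf').2 _ hf)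
    · exact hd f hf f' hf' v hvf hvf'

/-- Lying in different units, `v` and `w` remove at most one vertex from the triangle, and the
opposite edge survives. -/
theorem IsTriangleUnit.exists_edge_avoiding {q : Q} (h : G.IsTriangleUnit u q) {v w : V}
    (hvw : u v ≠ u w) :
    ∃ e ∈ G.edgeSet, ∀ x ∈ e, u x = q ∧ x ≠ v ∧ x ≠ w := by
  have aux : ∀ v w, u v ≠ u w → u v = q →
      ∃ e ∈ G.edgeSet, ∀ x ∈ e, u x = q ∧ x ≠ v ∧ x ≠ w := by
    intro v w hvw hv
    obtain ⟨y, z, hy, hz, hyz, h'⟩ := h.exists_mates hv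
    have huy : u y = q := (h' y).2 (by simp)
    have huz : u z = q := (h' z).2 (by simp)
    refine ⟨s(y, z), hyz, fun x hx => ?_⟩
    rcases Sym2.mem_iff.1 hx with rfl | rfl
    · exact ⟨huy, hy.ne', fun hxw => hvw (by rw [hv, ← hxw, huy])⟩
    · exact ⟨huz, hz.ne', fun hxw => hvw (by rw [hv, ← hxw, huz])⟩
  by_cases hv : u v = q
  · exact aux v w hvw hv
  by_cases hw : u w = q
  · obtain ⟨e, he, hx⟩ := aux w v hvw.symm hw
    exact ⟨e, he, fun x hxe => ⟨(hx x hxe).1, (hx x hxe).2.2, (hx x hxe).2.1⟩⟩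
  obtain ⟨x, y, z, hxy, -, -, h'⟩ := h
  refine ⟨s(x, y), hxy, fun p hp => ?_⟩
  have hup : u p = q := by
    rcases Sym2.mem_iff.1 hp with rfl | rfl <;> simp [h']
  exact ⟨hup, fun h => hv (h ▸ hup), fun h => hw (h ▸ hup)⟩

theorem IsUnitPartition.exists_edge (hu : G.IsUnitPartition u) (q : Q) :
    ∃ e ∈ G.edgeSet, ∀ x ∈ e, u x = q := by
  rcases hu q with ⟨x, y, _, hxy, -, -, h⟩ | ⟨x, y, _, _, hxy, -, -, -, -, -, -, h⟩ <;>
  · refine ⟨s(x, y), hxy, fun p hp => (h p).2 ?_⟩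
    rcases Sym2.mem_iff.1 hp with rfl | rfl <;> simp

/-- If a single unit is a diamond, then some edge joins two triangle units. -/
theorem IsUnitPartition.exists_adj_triangles (hG : G.Cubic) (hu : G.IsUnitPartition u) {q : Q}
    {a b c d : V} (hD : G.IsDiamond u q a b c d) (ht : ∀ r, r ≠ q → G.IsTriangleUnit u r) :
    ∃ v w, G.Adj v w ∧ u v ≠ u w ∧ u v ≠ q ∧ u w ≠ q := by
  obtain ⟨a', haa', ha'⟩ := hD.exists_outer hG
  obtain ⟨d', hdd', hd'⟩ := hD.swap.exists_outer hG
  have hua : u a = q := (hD.2.2.2.2.2.2.2 a).2 (by simp)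
  have hud : u d = q := (hD.2.2.2.2.2.2.2 d).2 (by simp)
  have hT := ht _ ha'
  obtain ⟨x, y, z, hxy, hxz, hyz, h⟩ := id hT
  -- Otherwise every outer edge of the triangle containing `a'` ends at `a` or `d`, so its three
  -- vertices lie in `{a', d'}`.
  by_contra! hcon
  have key : ∀ p, u p = u a' → p = a' ∨ p = d' := by
    intro p hp
    obtain ⟨w, hw, hwp⟩ := hT.exists_outer hG hp
    have hwq := hcon p w hw (by rw [hp]; exact hwp.symm) (by rw [hp]; exact ha')
    have hpq : u p ≠ q := by rw [hp]; exact ha'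
    rcases hD.eq_or_eq_of_adj hG hwq hw.symm hpq with rfl | rfl
    · exact Or.inl (hu.outer_unique hG haa' (by rwa [hua]) hw.symm (by rwa [hua]))
    · exact Or.inr (hu.outer_unique hG hdd' (by rwa [hud]) hw.symm (by rwa [hud]))
  have hx := key x ((h x).2 (by simp))
  have hy := key y ((h y).2 (by simp))
  have hz := key z ((h z).2 (by simp))
  have := hxy.ne
  have := hxz.ne
  have := hyz.ne
  rcases hx with rfl | rfl <;> rcases hy with rfl | rfl <;> rcases hz with rfl | rfl <;> simp_all

theorem IsUnitPartition.matching_of_triangles [Finite V] [Fintype Q] (hG : G.Cubic)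
    (hconn : G.Connected) (hu : G.IsUnitPartition u) (ht : ∀ q, G.IsTriangleUnit u q) :
    Fintype.card Q + 1 ≤ G.matchingNumber := by
  obtain ⟨p⟩ := hconn.nonempty
  obtain ⟨v, w, hv, hvw, hw⟩ := hu.exists_outer hG (u p)
  have := card_add_card_le_matchingNumber (G := G) (u := u) {s(v, w)} (by simpa using hvw)
    (by simp) (fun q => by
      obtain ⟨e, he, hx⟩ := (ht q).exists_edge_avoiding (v := v) (w := w) (by rw [hv]; exact hw.symm)
      refine ⟨e, he, fun x hxe => ⟨(hx x hxe).1, fun f hf => ?_⟩⟩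
      rw [Finset.mem_singleton.1 hf, Sym2.mem_iff, not_or]
      exact (hx x hxe).2)
  simpa using this

/-- A diamond holds two disjoint edges, one more than its share. The second extra edge `f` comes
from another diamond or, if there is none, joins two triangles. -/
theorem IsUnitPartition.matching_of_diamond [Finite V] [Fintype Q] (hG : G.Cubic)
    (hu : G.IsUnitPartition u) {q : Q} (hq : G.IsDiamondUnit u q) :
    Fintype.card Q + 2 ≤ G.matchingNumber := by
  classical
  obtain ⟨a, b, c, d, hD⟩ := hq
  obtain ⟨hab, hac, hbc, hbd, hcd, -, had, hDu⟩ := id hD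
  have hu' : ∀ x, x = a ∨ x = b ∨ x = c ∨ x = d → u x = q := fun x => (hDu x).2
  -- an edge `f` avoiding the diamond and missed by an edge of every other unit suffices
  have key : ∀ f ∈ G.edgeSet, (∀ x ∈ f, u x ≠ q) →
      (∀ r, r ≠ q → ∃ e ∈ G.edgeSet, ∀ x ∈ e, u x = r ∧ x ∉ f) →
      Fintype.card Q + 2 ≤ G.matchingNumber := by
    intro f hf hfq h
    have hx : ∀ x ∈ s(c, d), u x = q := by
      intro x hx
      rcases Sym2.mem_iff.1 hx with rfl | rfl
      · exact hu' _ (by simp)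
      · exact hu' _ (by simp)
    have hne : s(c, d) ≠ f := by
      rintro rfl
      exact hfq c (Sym2.mem_mk_left _ _) (hx c (Sym2.mem_mk_left _ _))
    have := card_add_card_le_matchingNumber (G := G) (u := u) {s(c, d), f}
      (by
        rw [Finset.coe_pair, Set.pair_subset_iff]
        exact ⟨hcd, hf⟩)
      (by
        intro e he e' he' v hv hv'
        rcases Finset.mem_insert.1 he with rfl | he <;>
        rcases Finset.mem_insert.1 he' with rfl | he'
        · rfl
        · rw [Finset.mem_singleton.1 he'] at hv'
          exact absurd (hx v hv) (hfq v hv')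
        · rw [Finset.mem_singleton.1 he] at hv
          exact absurd (hx v hv') (hfq v hv)
        · rw [Finset.mem_singleton.1 he, Finset.mem_singleton.1 he'])
      (fun r => by
        by_cases hr : r = q
        · subst hr
          refine ⟨s(a, b), hab, fun x hxe => ?_⟩
          have hxu : u x = r := by
            rcases Sym2.mem_iff.1 hxe with rfl | rfl <;> exact hu' _ (by simp)
          refine ⟨hxu, fun e he => ?_⟩
          rcases Finset.mem_insert.1 he with rfl | he
          · rw [Sym2.mem_iff, not_or]
            rcases Sym2.mem_iff.1 hxe with rfl | rfl
            exacts [⟨hac.ne, had⟩, ⟨hbc.ne, hbd.ne⟩]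
          · rw [Finset.mem_singleton.1 he]
            exact fun h => hfq x h hxu
        · obtain ⟨e, he, hxe⟩ := h r hr
          refine ⟨e, he, fun x hx' => ⟨(hxe x hx').1, fun e' he' => ?_⟩⟩
          rcases Finset.mem_insert.1 he' with rfl | he'
          · exact fun h' => hr ((hxe x hx').1.symm.trans (hx x h'))
          · rw [Finset.mem_singleton.1 he']
            exact (hxe x hx').2)
    rwa [Finset.card_pair hne] at this
  by_cases ht : ∀ r, r ≠ q → G.IsTriangleUnit u r
  · obtain ⟨v, w, hvw, hne, hv, hw⟩ := hu.exists_adj_triangles hG hD ht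
    refine key s(v, w) hvw ?_ fun r hr => ?_
    · intro x hx
      rcases Sym2.mem_iff.1 hx with rfl | rfl <;> assumption
    · obtain ⟨e, he, hx⟩ := (ht r hr).exists_edge_avoiding hne
      refine ⟨e, he, fun x hxe => ⟨(hx x hxe).1, ?_⟩⟩
      rw [Sym2.mem_iff, not_or]
      exact (hx x hxe).2
  · push Not at ht
    obtain ⟨r, hr, hrt⟩ := ht
    obtain ⟨x, y, z, w, hxy, hxz, hyz, hyw, hzw, -, hxw, hRu⟩ := (hu r).resolve_left hrt
    have hzwr : ∀ p ∈ s(z, w), u p = r := by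
      intro p hp
      rcases Sym2.mem_iff.1 hp with rfl | rfl <;> exact (hRu _).2 (by simp)
    refine key s(z, w) hzw (fun p hp => by rwa [hzwr p hp]) fun t _ => ?_
    by_cases htr : t = r
    · subst htr
      refine ⟨s(x, y), hxy, fun p hp => ?_⟩
      rw [Sym2.mem_iff, not_or]
      rcases Sym2.mem_iff.1 hp with rfl | rfl
      exacts [⟨(hRu _).2 (by simp), hxz.ne, hxw⟩, ⟨(hRu _).2 (by simp), hyz.ne, hyw.ne⟩]
    · obtain ⟨e, he, hxe⟩ := hu.exists_edge t
      exact ⟨e, he, fun p hp => ⟨hxe p hp, fun h => htr ((hxe p hp).symm.trans (hzwr p h))⟩⟩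

end SimpleGraph

/-! ### Comparison of the bounds. -/

theorem theorem3p1 {V : Type*} [Fintype V] (G : SimpleGraph V) [DecidableRel G.Adj]
    (hconn : G.Connected) (hclaw : G.ClawFree) (hcubic : G.IsRegularOfDegree 3)
    (hK4 : IsEmpty (G ≃g SimpleGraph.completeGraph (Fin 4))) :
    G.zeroForcingNumber ≤ G.indepNum + 1 ∧ G.zeroForcingNumber ≤ G.matchingNumber := by
  classical
  have hG := hcubic.cubic
  have hu := SimpleGraph.isUnitPartition_triangleEdgeGraph hG hclaw fun a b c d h1 h2 h3 h4 h5 =>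
    hG.not_completeGraph_four hconn hK4 h1 h2 h3 h4 h5
  have : Fintype G.triangleEdgeGraph.ConnectedComponent := Fintype.ofFinite _
  by_cases ht : ∀ q, G.IsTriangleUnit G.triangleEdgeGraph.connectedComponentMk q
  · have h1 := hu.zeroForcingNumber_le_of_triangles hG hconn ht
    have h2 := hu.card_le_indepNum hG ht
    have h3 := hu.matching_of_triangles hG hconn ht
    omega
  · push Not at ht
    obtain ⟨q, hq⟩ := ht
    have hq := (hu q).resolve_left hq
    have h1 := hu.zeroForcingNumber_le hG hconn
    have h2 := hu.card_lt_indepNum hG hq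
    have h3 := hu.matching_of_diamond hG hq
    omega
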